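/- Let $M$ be a paracompact (Hausdorff) $C^\infty$ manifold of finite dimension, and let $L$ be a $C^\infty$ vector $1$-form on $M$ (a field of endomorphisms $L_z:T_zM\to T_zM$) of constant rank $n\ge 1$, whose Nijenhuis tensor $N_L=\frac12[L,L]$ vanishes and such that $\operatorname{Im}(L_z)=\operatorname{Ker}(L_z)$ for all $z\in M$ (so $\dim M=2n$). Let $\Gamma$ be an $L$-connection on $M$, i.e. a $C^\infty$ vector $1$-form with $L\Gamma=L$ and $\Gamma L=-L$. Let $h=\frac12(I+\Gamma)$ be its horizontal projector, $H_z(M)=\operatorname{Im}(h_z)$ the horizontal space at $z$, and $R=-\frac12[h,h]$ its curvature. Here $[K,P]$ denotes the Frölicher–Nijenhuis bracket of vector $1$-forms, $$[K,P](X,Y)=[KX,PY]+[PX,KY]+(KP+PK)[X,Y]-K\big([PX,Y]+[X,PY]\big)-P\big([KX,Y]+[X,KY]\big)$$ for $C^\infty$ vector fields $X,Y$. Then the following assertions are equivalent: (a) the horizontal distribution $z\mapsto H_z(M)$ is completely integrable, i.e. around every point of $M$ there is a $C^\infty$ chart $(x^1,\dots,x^n,y^1,\dots,y^n)$ in whose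 domain the distribution is defined by the equations $dy^1=\dots=dy^n=0$; (b) the Nijenhuis tensor $N_\Gamma=\frac12[\Gamma,\Gamma]$ of $\Gamma$ vanishes; (c) the curvature $R$ of $\Gamma$ vanishes. -/

import Mathlib

open scoped Manifold ContDiff

noncomputable section

namespace LConn

variable {E : Type*} [NormedAddCommGroup E] [NormedSpace ℝ E]
  {M : Type*} [TopologicalSpace M] [ChartedSpace E M]

/-- A (rough) vector field on `M`: a section of the tangent bundle, of no assumed regularity. -/
abbrev VField (E : Type*) [NormedAddCommGroup E] [NormedSpace ℝ E]
    (M : Type*) [TopologicalSpace M] [ChartedSpace E M] : Type _ :=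
  ∀ x : M, TangentSpace 𝓘(ℝ, E) x

/-- A (rough) vector `1`-form on `M`: a field of endomorphisms of the tangent spaces. -/
abbrev VOneForm (E : Type*) [NormedAddCommGroup E] [NormedSpace ℝ E]
    (M : Type*) [TopologicalSpace M] [ChartedSpace E M] : Type _ :=
  ∀ x : M, TangentSpace 𝓘(ℝ, E) x →L[ℝ] TangentSpace 𝓘(ℝ, E) x

/-- The type in which vector `2`-forms live, seen as operations `(X, Y) ↦ B(X, Y)` on pairs of
vector fields. -/
abbrev VTwoForm (E : Type*) [NormedAddCommGroup E] [NormedSpace ℝ E]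
    (M : Type*) [TopologicalSpace M] [ChartedSpace E M] : Type _ :=
  VField E M → VField E M → VField E M

/-- The vector field `X` is of class `C^∞`. -/
def SmoothField [IsManifold 𝓘(ℝ, E) ∞ M] (X : VField E M) : Prop :=
  ContMDiff 𝓘(ℝ, E) 𝓘(ℝ, E).tangent ∞
    (fun x => (⟨x, X x⟩ : TangentBundle 𝓘(ℝ, E) M))

/-- The vector `1`-form `K` is of class `C^∞`, as a section of the bundle `End(TM)`. -/
def SmoothForm [IsManifold 𝓘(ℝ, E) ∞ M] (K : VOneForm E M) : Prop :=
  ContMDiff 𝓘(ℝ, E) (𝓘(ℝ, E).prod 𝓘(ℝ, E →L[ℝ] E)) ∞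
    (fun x => Bundle.TotalSpace.mk' (E →L[ℝ] E)
      (E := fun x : M => TangentSpace 𝓘(ℝ, E) x →L[ℝ] TangentSpace 𝓘(ℝ, E) x) x (K x))

/-- The vector field `K X`. -/
def app (K : VOneForm E M) (X : VField E M) : VField E M := fun x => K x (X x)

/-- The Lie bracket `[X, Y]` of vector fields. -/
def lie (X Y : VField E M) : VField E M := VectorField.mlieBracket 𝓘(ℝ, E) X Y

/-- The Frölicher–Nijenhuis bracket `[K, P]` of two vector `1`-forms, as a vector `2`-form:
`[K, P](X, Y) = [KX, PY] + [PX, KY] + (KP + PK)[X, Y]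
  - K([PX, Y] + [X, PY]) - P([KX, Y] + [X, KY])`. -/
def fnBracket (K P : VOneForm E M) : VTwoForm E M := fun X Y =>
  lie (app K X) (app P Y) + lie (app P X) (app K Y)
    + (app K (app P (lie X Y)) + app P (app K (lie X Y)))
    - app K (lie (app P X) Y + lie X (app P Y))
    - app P (lie (app K X) Y + lie X (app K Y))

/-- The Nijenhuis tensor `N_K = ½ [K, K]` of a vector `1`-form. -/
def nijenhuis (K : VOneForm E M) : VTwoForm E M := fun X Y =>
  (1 / 2 : ℝ) • fnBracket K K X Y

/-- A vector `2`-form vanishes when it vanishes on all pairs of `C^∞` vector fields. -/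
def Vanishes [IsManifold 𝓘(ℝ, E) ∞ M] (B : VTwoForm E M) : Prop :=
  ∀ X Y : VField E M, SmoothField X → SmoothField Y → B X Y = 0

/-- The structure carried by `M`: a `C^∞` vector `1`-form `L` of constant rank `n`, with vanishing
Nijenhuis tensor, and whose image coincides with its kernel at each point. -/
structure IsTangentStructure [IsManifold 𝓘(ℝ, E) ∞ M] (n : ℕ) (L : VOneForm E M) : Prop where
  smooth : SmoothForm L
  rank_eq : ∀ z, Module.finrank ℝ (L z).range = n
  nijenhuis_eq_zero : Vanishes (nijenhuis L)
  range_eq_ker : ∀ z, (L z).range = (L z).ker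

/-- `Γ` is an `L`-connection: a `C^∞` vector `1`-form with `L Γ = L` and `Γ L = -L`. -/
structure IsLConnection [IsManifold 𝓘(ℝ, E) ∞ M] (L Γ : VOneForm E M) : Prop where
  smooth : SmoothForm Γ
  comp_left : ∀ z, (L z).comp (Γ z) = L z
  comp_right : ∀ z, (Γ z).comp (L z) = -(L z)

/-- The horizontal projector `h = ½ (I + Γ)`. -/
def hproj (Γ : VOneForm E M) : VOneForm E M := fun z =>
  (1 / 2 : ℝ) • (ContinuousLinearMap.id ℝ (TangentSpace 𝓘(ℝ, E) z) + Γ z)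

/-- The horizontal space `H_z(M) = Im(h_z)`. -/
def horizontal (Γ : VOneForm E M) (z : M) : Submodule ℝ (TangentSpace 𝓘(ℝ, E) z) :=
  (hproj Γ z).range

/-- The curvature `R = -½ [h, h]`. -/
def curvature (Γ : VOneForm E M) : VTwoForm E M := fun X Y =>
  -((1 / 2 : ℝ) • fnBracket (hproj Γ) (hproj Γ) X Y)

/-- A distribution `D` is completely integrable: around each point there is a chart `φ` of the
`C^∞` structure which is flat for `D`, i.e. the differential of `φ` carries `D` to one fixed linear
subspace `W` of the model space (so that, after a linear change of coordinates adapted to `W`,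
`D` is spanned by the first coordinate vector fields, and is given by the vanishing of the
differentials of the remaining coordinates). -/
def CompletelyIntegrable [IsManifold 𝓘(ℝ, E) ∞ M]
    (D : ∀ z : M, Submodule ℝ (TangentSpace 𝓘(ℝ, E) z)) : Prop :=
  ∀ z : M, ∃ φ ∈ IsManifold.maximalAtlas 𝓘(ℝ, E) ∞ M, z ∈ φ.source ∧
    ∃ W : Submodule ℝ E, ∀ w ∈ φ.source, ∀ ξ : TangentSpace 𝓘(ℝ, E) w,
      ξ ∈ D w ↔ (mfderiv 𝓘(ℝ, E) 𝓘(ℝ, E) φ w ξ : E) ∈ W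

end LConn

end

/-!
Since `L Γ = L` and `Γ L = -L`, the form `Γ` is an almost product structure, `Γ² = 1`, so
`h = ½ (1 + Γ)` is a projector, with kernel the vertical distribution `Ker L`. As `1` does not
contribute to Frölicher–Nijenhuis brackets, `[h, h] = ¼ [Γ, Γ]`, whence (b) ⇔ (c). For a projector,
`½ [h, h](X, Y) = (1 - h)[hX, hY] + h[(1 - h)X, (1 - h)Y]`, so `[h, h] = 0` if and only if both
`Im h` and `Ker h` are involutive. The vertical distribution is involutive: `N_L = 0` gives
`L[U, LA] = 0` for `U` vertical, and at a given point a vertical field may be replaced by some `LA`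
because its image under the Lie derivative `𝓛_U L` depends only on its value there. Thus (c) says
that the horizontal distribution is involutive, and the theorem of Frobenius gives (c) ⇔ (a).

To straighten the image of a projector field `P` near `e₀`, replace `P` by the projectors `S`
with the same images and the constant kernel `Ker P(e₀)`. Involutivity becomes the symmetry in
`(x, y)` of `S'(Sx) y`, the integrability condition of `dG = S(G)`. The solutions of
`γ' = S(γ) ξ`, `γ(0) = a` depend smoothly on `(a, ξ)` by the implicit function theorem in the Banach
space of paths, and the symmetry makes `t ↦ t S(γ) η` the derivative of `γ` in the direction `η`;
hence `G(a, ξ) = γ(1)` satisfies `dG = S(G)` in `ξ`, and its values along `ξ ∈ Im P(e₀)` are the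
leaves.
-/

noncomputable section

open Set Filter Topology VectorField

universe u

namespace Frobenius

open unitInterval

section Superposition

variable {K : Type*} [TopologicalSpace K] [CompactSpace K]

/-- Pointwise evaluation of a continuous family of continuous linear maps at a continuous family of
vectors, as a continuous bilinear map; it expresses the derivative of a superposition operator. -/
def clmApply (K E F : Type*) [TopologicalSpace K] [CompactSpace K]
    [NormedAddCommGroup E] [NormedSpace ℝ E] [NormedAddCommGroup F] [NormedSpace ℝ F] :
    C(K, E →L[ℝ] F) →L[ℝ] C(K, E) →L[ℝ] C(K, F) :=
  LinearMap.mkContinuous₂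
    (LinearMap.mk₂ ℝ (fun (A : C(K, E →L[ℝ] F)) (γ : C(K, E)) ↦
      (⟨fun t ↦ A t (γ t), A.continuous.clm_apply γ.continuous⟩ : C(K, F)))
      (fun _ _ _ ↦ by ext; simp) (fun _ _ _ ↦ by ext; simp)
      (fun _ _ _ ↦ by ext; simp) (fun _ _ _ ↦ by ext; simp)) 1 fun A γ ↦ by
    rw [one_mul, ContinuousMap.norm_le _ (by positivity)]
    intro t
    refine ((A t).le_opNorm _).trans ?_
    gcongr
    exacts [A.norm_coe_le_norm t, γ.norm_coe_le_norm t]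

@[simp]
theorem clmApply_apply {E F : Type*} [NormedAddCommGroup E] [NormedSpace ℝ E]
    [NormedAddCommGroup F] [NormedSpace ℝ F] (A : C(K, E →L[ℝ] F)) (γ : C(K, E)) (t : K) :
    clmApply K E F A γ t = A t (γ t) := rfl

/-- The derivative of a `C¹` map as a continuous map. -/
def fderivMap {E F : Type*} [NormedAddCommGroup E] [NormedSpace ℝ E] [NormedAddCommGroup F]
    [NormedSpace ℝ F] (f : E → F) (hf : ContDiff ℝ 1 f) : C(E, E →L[ℝ] F) :=
  ⟨fderiv ℝ f, hf.continuous_fderiv one_ne_zero⟩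

theorem hasFDerivAt_superposition {E F : Type*} [NormedAddCommGroup E] [NormedSpace ℝ E]
    [NormedAddCommGroup F] [NormedSpace ℝ F] (f : C(E, F)) (hf : ContDiff ℝ 1 f) (γ : C(K, E)) :
    HasFDerivAt (fun η : C(K, E) ↦ f.comp η)
      (clmApply K E F ((fderivMap f hf).comp γ)) γ := by
  set f' := fderivMap f hf
  have hf' (x : E) : HasFDerivAt f (f' x) x :=
    (hf.differentiable one_ne_zero x).hasFDerivAt
  rw [hasFDerivAt_iff_isLittleO_nhds_zero, Asymptotics.isLittleO_iff]
  intro ε hε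
  have hcont : Continuous fun η : C(K, E) ↦ f'.comp η := ContinuousMap.continuous_postcomp f'
  obtain ⟨δ, hδ, H⟩ :=
    (Metric.continuousAt_iff (α := C(K, E)) (β := C(K, E →L[ℝ] F))).1
      hcont.continuousAt ε hε
  filter_upwards [Metric.ball_mem_nhds (0 : C(K, E)) hδ] with h hh
  rw [ContinuousMap.norm_le _ (by positivity)]
  intro t
  have hclose : ∀ x ∈ segment ℝ (γ t) (γ t + h t), ‖f' x - f' (γ t)‖ ≤ ε := by
    intro x hx
    rw [segment_eq_image'] at hx
    obtain ⟨s, hs, rfl⟩ := hx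
    have hdist : dist (γ + s • h) γ < δ := by
      rw [dist_eq_norm, add_sub_cancel_left, norm_smul, Real.norm_eq_abs, abs_of_nonneg hs.1]
      exact (mul_le_of_le_one_left (norm_nonneg h) hs.2).trans_lt (by simpa using hh)
    simpa [dist_eq_norm] using (ContinuousMap.dist_apply_le_dist t).trans (H hdist).le
  have hmvt :=
    (convex_segment (𝕜 := ℝ) (γ t) (γ t + h t)).norm_image_sub_le_of_norm_hasFDerivWithin_le'
      (fun x _ ↦ (hf' x).hasFDerivWithinAt) hclose (left_mem_segment ℝ _ _)
      (right_mem_segment ℝ _ _)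
  rw [add_sub_cancel_left] at hmvt
  refine le_trans (by simpa using hmvt) ?_
  gcongr
  exact h.norm_coe_le_norm t

theorem contDiff_superposition {E F : Type u} [NormedAddCommGroup E] [NormedSpace ℝ E]
    [NormedAddCommGroup F] [NormedSpace ℝ F] (f : C(E, F)) {n : ℕ} (hf : ContDiff ℝ n f) :
    ContDiff ℝ n fun η : C(K, E) ↦ f.comp η := by
  induction n generalizing F with
  | zero => exact contDiff_zero.2 (ContinuousMap.continuous_postcomp f)
  | succ n ih =>
    have hf1 : ContDiff ℝ 1 f := hf.of_le (by norm_cast; omega)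
    have hd := hasFDerivAt_superposition (K := K) f hf1
    rw [Nat.cast_succ, contDiff_succ_iff_fderiv] at hf ⊢
    refine ⟨fun γ ↦ (hd γ).differentiableAt, by simp, ?_⟩
    rw [funext fun γ ↦ (hd γ).fderiv]
    exact (clmApply K E F).contDiff.comp (ih (fderivMap f hf1) hf.2.2)

end Superposition

section Paths

/-- Constant maps, as a continuous linear map into the space of continuous maps. -/
def constCLM (K E : Type*) [TopologicalSpace K] [CompactSpace K] [NormedAddCommGroup E]
    [NormedSpace ℝ E] : E →L[ℝ] C(K, E) :=
  LinearMap.mkContinuous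
    { toFun := ContinuousMap.const K
      map_add' := fun _ _ ↦ rfl
      map_smul' := fun _ _ ↦ rfl } 1 fun v ↦ by
    rw [one_mul, ContinuousMap.norm_le _ (by positivity)]
    exact fun _ ↦ le_rfl

@[simp]
theorem constCLM_apply {K E : Type*} [TopologicalSpace K] [CompactSpace K] [NormedAddCommGroup E]
    [NormedSpace ℝ E] (v : E) (t : K) : constCLM K E v t = v := rfl

variable {E : Type*} [NormedAddCommGroup E] [NormedSpace ℝ E]

/-- The primitive vanishing at `0` of a path, defined on the whole real line by extending the path
by its end values. -/
def primitive (γ : C(I, E)) (t : ℝ) : E :=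
  ∫ s in (0 : ℝ)..t, IccExtend (zero_le_one' ℝ) γ s

theorem hasDerivAt_primitive [CompleteSpace E] (γ : C(I, E)) (t : I) :
    HasDerivAt (primitive γ) (γ t) t := by
  have h : HasDerivAt (primitive γ) (IccExtend (zero_le_one' ℝ) γ t) t :=
    (γ.continuous.Icc_extend'.integral_hasStrictDerivAt 0 (t : ℝ)).hasDerivAt
  rwa [IccExtend_val] at h

theorem eq_primitive_of_hasDerivAt [CompleteSpace E] {f : ℝ → E} {γ : C(I, E)}
    (hf₀ : f 0 = 0) (hf : ∀ t : I, HasDerivAt f (γ t) t) (t : I) : f t = primitive γ t := by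
  rw [primitive, intervalIntegral.integral_eq_sub_of_hasDerivAt (f := f) (fun s hs ↦ ?_)
    (γ.continuous.Icc_extend'.intervalIntegrable _ _), hf₀, sub_zero]
  rw [uIcc_of_le t.2.1] at hs
  have hs' : s ∈ I := ⟨hs.1, hs.2.trans t.2.2⟩
  rw [IccExtend_of_mem _ _ hs']
  exact hf ⟨s, hs'⟩

variable (E) in
/-- Integration from the origin, as a continuous linear operator on paths. -/
def integrate : C(I, E) →L[ℝ] C(I, E) :=
  LinearMap.mkContinuous
    { toFun := fun γ ↦ ⟨fun t ↦ primitive γ t, by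
        have hγ : Continuous (primitive γ) := intervalIntegral.continuous_primitive
          (fun a b ↦ γ.continuous.Icc_extend'.intervalIntegrable a b) 0
        exact hγ.comp continuous_subtype_val⟩
      map_add' := fun γ η ↦ by
        ext t
        exact intervalIntegral.integral_add (γ.continuous.Icc_extend'.intervalIntegrable _ _)
          (η.continuous.Icc_extend'.intervalIntegrable _ _)
      map_smul' := fun c γ ↦ by
        ext t
        exact intervalIntegral.integral_smul c _ } 1 fun γ ↦ by
    rw [one_mul, ContinuousMap.norm_le _ (by positivity)]
    intro t
    have h : ‖primitive γ t‖ ≤ ‖γ‖ * |(t : ℝ) - 0| :=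
      intervalIntegral.norm_integral_le_of_norm_le_const fun s _ ↦ γ.norm_coe_le_norm _
    refine h.trans (mul_le_of_le_one_right (norm_nonneg γ) ?_)
    rw [sub_zero, abs_of_nonneg t.2.1]
    exact t.2.2

@[simp]
theorem integrate_apply (γ : C(I, E)) (t : I) :
    integrate E γ t = primitive γ t := rfl

end Paths

section ImplicitFunction

variable {X Y : Type*} [NormedAddCommGroup X] [NormedSpace ℝ X] [CompleteSpace X]
  [NormedAddCommGroup Y] [NormedSpace ℝ Y]

theorem isOpen_isInvertible : IsOpen {A : X →L[ℝ] Y | A.IsInvertible} :=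
  ContinuousLinearEquiv.isOpen

variable [CompleteSpace Y] {Z : Type*} [NormedAddCommGroup Z] [NormedSpace ℝ Z] [CompleteSpace Z]

theorem exists_smooth_implicitFunction {f : X × Y → Z} (hf : ContDiff ℝ ∞ f) {p : X × Y}
    (hp : f p = 0) (hinv : (fderiv ℝ f p ∘L .inr ℝ X Y).IsInvertible) :
    ∃ φ : X → Y, φ p.1 = p.2 ∧ ∀ᶠ x in 𝓝 p.1, ContDiffAt ℝ ∞ φ x ∧ f (x, φ x) = 0 ∧
      (fderiv ℝ f (x, φ x) ∘L .inr ℝ X Y).IsInvertible := by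
  have htop : (∞ : ℕ∞ω) ≠ 0 := by simp
  let φ := hf.contDiffAt.implicitFunction htop hinv
  have hφp : φ p.1 = p.2 := hf.contDiffAt.implicitFunction_apply_self htop hinv
  have hφ1 : ContDiffAt ℝ 1 φ p.1 :=
    (hf.contDiffAt.contDiffAt_implicitFunction htop hinv).of_le (by simp)
  have hzero : ∀ᶠ x in 𝓝 p.1, f (x, φ x) = 0 := by
    simpa only [hp] using hf.contDiffAt.eventually_apply_implicitFunction htop hinv
  have hcont : ContinuousAt (fun x ↦ fderiv ℝ f (x, φ x) ∘L .inr ℝ X Y) p.1 :=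
    ((hf.continuous_fderiv htop).continuousAt.comp
      (continuousAt_id.prodMk hφ1.continuousAt)).clm_comp continuousAt_const
  have hinv' : ∀ᶠ x in 𝓝 p.1, (fderiv ℝ f (x, φ x) ∘L .inr ℝ X Y).IsInvertible :=
    hcont.eventually_mem (isOpen_isInvertible.mem_nhds (by simpa [hφp] using hinv))
  refine ⟨φ, hφp, ?_⟩
  filter_upwards [hφ1.eventually (by simp), hzero.eventually_nhds, hinv'] with x hx hx0 hxinv
  refine ⟨?_, hx0.self_of_nhds, hxinv⟩
  -- Near `x`, uniqueness identifies `φ` with the implicit function based at `(x, φ x)`.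
  have hψ := hf.contDiffAt.contDiffAt_implicitFunction htop hxinv
  refine hψ.congr_of_eventuallyEq ?_
  have hgraph : ContinuousAt (fun y ↦ (y, φ y)) x := continuousAt_id.prodMk hx.continuousAt
  filter_upwards [hx0, hgraph.eventually
    (hf.contDiffAt.eventually_apply_eq_iff_implicitFunction htop hxinv)] with y hy0 hy
  exact (hy.1 (hy0.trans hx0.self_of_nhds.symm)).symm

end ImplicitFunction

section PathEquation

variable {E F : Type u} [NormedAddCommGroup E] [NormedSpace ℝ E]
  [NormedAddCommGroup F] [NormedSpace ℝ F]

/-- The defect of a path `γ` as a solution of `γ' = S(γ) ξ`, `γ(0) = a`, in integral form, as a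
function of `((a, ξ), γ)`. -/
def pathDefect (S : C(E, F →L[ℝ] E)) (p : (E × F) × C(I, E)) : C(I, E) :=
  p.2 - constCLM I E p.1.1 - integrate E (clmApply I F E (S.comp p.2) (constCLM I F p.1.2))

theorem contDiff_pathDefect {S : C(E, F →L[ℝ] E)} (hS : ContDiff ℝ ∞ S) :
    ContDiff ℝ ∞ (pathDefect S) := by
  have hsup : ContDiff ℝ ∞ fun γ : C(I, E) ↦ S.comp γ :=
    contDiff_infty.2 fun n ↦ contDiff_superposition S (hS.of_le (by exact_mod_cast le_top))
  have happ : ContDiff ℝ ∞ fun p : (E × F) × C(I, E) ↦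
      clmApply I F E (S.comp p.2) (constCLM I F p.1.2) :=
    ((clmApply I F E).contDiff.comp (hsup.comp contDiff_snd)).clm_apply
      ((constCLM I F).contDiff.comp contDiff_fst.snd)
  exact (contDiff_snd.sub ((constCLM I E).contDiff.comp contDiff_fst.fst)).sub
    ((integrate E).contDiff.comp happ)

theorem fderiv_pathDefect_apply {S : C(E, F →L[ℝ] E)} (hS : ContDiff ℝ 1 S)
    (p q : (E × F) × C(I, E)) :
    fderiv ℝ (pathDefect S) p q = q.2 - constCLM I E q.1.1 -
      integrate E (clmApply I F E (S.comp p.2) (constCLM I F q.1.2) +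
        clmApply I F E (clmApply I E (F →L[ℝ] E) ((fderivMap S hS).comp p.2) q.2)
          (constCLM I F p.1.2)) := by
  have hsup : HasFDerivAt (fun p : (E × F) × C(I, E) ↦ S.comp p.2) _ p :=
    (hasFDerivAt_superposition S hS p.2).comp p hasFDerivAt_snd
  have happ : HasFDerivAt (fun p : (E × F) × C(I, E) ↦
      clmApply I F E (S.comp p.2) (constCLM I F p.1.2)) _ p :=
    ((clmApply I F E).hasFDerivAt.comp p hsup).clm_apply
      ((constCLM I F).hasFDerivAt.comp p hasFDerivAt_fst.snd)
  have h : HasFDerivAt (pathDefect S) _ p :=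
    (hasFDerivAt_snd.sub ((constCLM I E).hasFDerivAt.comp p hasFDerivAt_fst.fst)).sub
      ((integrate E).hasFDerivAt.comp p happ)
  rw [h.fderiv]
  rfl

theorem pathDefect_const (S : C(E, F →L[ℝ] E)) (e : E) :
    pathDefect S ((e, 0), constCLM I E e) = 0 := by
  simp [pathDefect]

theorem fderiv_pathDefect_comp_inr {S : C(E, F →L[ℝ] E)} (hS : ContDiff ℝ 1 S) (e : E) :
    fderiv ℝ (pathDefect S) ((e, 0), constCLM I E e) ∘L .inr ℝ (E × F) C(I, E) = .id ℝ _ := by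
  ext1 η
  simp [fderiv_pathDefect_apply hS]

theorem exists_hasDerivAt_of_pathDefect_eq_zero [CompleteSpace E] {S : C(E, F →L[ℝ] E)}
    {a : E} {ξ : F} {γ : C(I, E)} (h : pathDefect S ((a, ξ), γ) = 0) :
    ∃ g : ℝ → E, ∀ t : I, g t = γ t ∧ HasDerivAt g (S (γ t) ξ) t := by
  let c : C(I, E) := clmApply I F E (S.comp γ) (constCLM I F ξ)
  refine ⟨fun t ↦ a + primitive c t, fun t ↦ ⟨?_, (hasDerivAt_primitive c t).const_add a⟩⟩
  have ht : γ t - a - primitive c t = 0 := DFunLike.congr_fun h t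
  rw [sub_eq_zero] at ht
  simp [← ht]

theorem fderiv_pathDefect_smul [CompleteSpace E] {S : C(E, F →L[ℝ] E)} (hS : ContDiff ℝ 1 S)
    {p : E × F} {γ : C(I, E)} (hγ : pathDefect S (p, γ) = 0)
    (hsymm : ∀ t x y, fderiv ℝ S (γ t) (S (γ t) x) y = fderiv ℝ S (γ t) (S (γ t) y) x)
    (η : F) {V : C(I, E)} (hV : ∀ t : I, V t = (t : ℝ) • S (γ t) η) :
    fderiv ℝ (pathDefect S) (p, γ) ((0, η), V) = 0 := by
  obtain ⟨g, hg⟩ := exists_hasDerivAt_of_pathDefect_eq_zero hγ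
  rw [fderiv_pathDefect_apply hS, sub_eq_zero]
  ext t
  rw [map_zero, sub_zero, hV, ← (hg t).1, integrate_apply]
  refine eq_primitive_of_hasDerivAt (f := fun s ↦ s • S (g s) η) (by simp) (fun s ↦ ?_) t
  obtain ⟨hgs, hgs'⟩ := hg s
  have hSg : HasDerivAt (fun r ↦ S (g r)) (fderiv ℝ S (γ s) (S (γ s) p.2)) (s : ℝ) :=
    HasFDerivAt.comp_hasDerivAt (s : ℝ)
      (by rw [hgs]; exact (hS.differentiable one_ne_zero _).hasFDerivAt) hgs'
  convert (hasDerivAt_id (s : ℝ)).smul (hSg.clm_apply (hasDerivAt_const (s : ℝ) η)) using 1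
  · rfl
  · rw [hsymm s _ η, hgs]
    simp only [ContinuousMap.coe_add, Pi.add_apply, clmApply_apply, ContinuousMap.comp_apply,
      constCLM_apply, hV, map_smul, _root_.smul_apply, map_zero, add_zero, one_smul]
    exact add_comm _ _

theorem exists_smooth_path [CompleteSpace E] [CompleteSpace F] {S : C(E, F →L[ℝ] E)}
    (hS : ContDiff ℝ ∞ S) (e₀ : E) :
    ∃ g : E × F → C(I, E), g (e₀, 0) = constCLM I E e₀ ∧ ∀ᶠ p in 𝓝 (e₀, 0),
      ContDiffAt ℝ ∞ g p ∧ pathDefect S (p, g p) = 0 ∧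
        ∀ η, fderiv ℝ (pathDefect S) (p, g p) (0, η) = 0 → η = 0 := by
  have hinv : (fderiv ℝ (pathDefect S) ((e₀, 0), constCLM I E e₀) ∘L
      .inr ℝ (E × F) C(I, E)).IsInvertible := by
    rw [fderiv_pathDefect_comp_inr (hS.of_le (by simp))]
    exact ContinuousLinearMap.isInvertible_equiv (f := .refl ℝ C(I, E))
  obtain ⟨g, hg₀, hg⟩ :=
    exists_smooth_implicitFunction (contDiff_pathDefect hS) (pathDefect_const S e₀) hinv
  refine ⟨g, hg₀, hg.mono fun p ⟨hsmooth, hzero, hp⟩ ↦ ⟨hsmooth, hzero, fun η hη ↦ ?_⟩⟩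
  exact hp.injective (hη.trans (map_zero _).symm)

theorem fderiv_apply_graph_eq_zero {X Y Z : Type*} [NormedAddCommGroup X] [NormedSpace ℝ X]
    [NormedAddCommGroup Y] [NormedSpace ℝ Y] [NormedAddCommGroup Z] [NormedSpace ℝ Z]
    {f : X × Y → Z} {g : X → Y} {p : X} (hf : DifferentiableAt ℝ f (p, g p))
    (hg : DifferentiableAt ℝ g p) (hzero : ∀ᶠ q in 𝓝 p, f (q, g q) = 0) (q : X) :
    fderiv ℝ f (p, g p) (q, fderiv ℝ g p q) = 0 := by
  have h1 : HasFDerivAt (fun q ↦ f (q, g q)) _ p :=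
    hf.hasFDerivAt.comp p ((hasFDerivAt_id p).prodMk hg.hasFDerivAt)
  have h2 : HasFDerivAt (fun q ↦ f (q, g q)) (0 : X →L[ℝ] Z) p :=
    (hasFDerivAt_const (0 : Z) p).congr_of_eventuallyEq hzero
  exact DFunLike.congr_fun (h1.unique h2) q

theorem fderiv_path_apply [CompleteSpace E] {S : C(E, F →L[ℝ] E)} (hS : ContDiff ℝ ∞ S)
    {g : E × F → C(I, E)} {p : E × F} (hg : DifferentiableAt ℝ g p)
    (hzero : ∀ᶠ q in 𝓝 p, pathDefect S (q, g q) = 0)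
    (hinj : ∀ η, fderiv ℝ (pathDefect S) (p, g p) (0, η) = 0 → η = 0)
    (hsymm : ∀ t x y, fderiv ℝ S (g p t) (S (g p t) x) y = fderiv ℝ S (g p t) (S (g p t) y) x)
    (η : F) (t : I) : fderiv ℝ g p (0, η) t = (t : ℝ) • S (g p t) η := by
  let V : C(I, E) := ⟨fun t ↦ (t : ℝ) • S (g p t) η, by fun_prop⟩
  have hV : fderiv ℝ (pathDefect S) (p, g p) ((0, η), V) = 0 :=
    fderiv_pathDefect_smul (hS.of_le (by simp)) hzero.self_of_nhds hsymm η fun _ ↦ rfl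
  have hdg : fderiv ℝ (pathDefect S) (p, g p) ((0, η), fderiv ℝ g p (0, η)) = 0 :=
    fderiv_apply_graph_eq_zero ((contDiff_pathDefect hS).differentiable (by simp) _) hg hzero _
  have hsub : fderiv ℝ g p (0, η) - V = 0 := by
    refine hinj _ ?_
    rw [← sub_self ((0 : E), η), ← Prod.mk_sub_mk, map_sub, hdg, hV, sub_zero]
  rw [sub_eq_zero.1 hsub]
  rfl

theorem eventually_forall_apply {X K Y : Type*} [TopologicalSpace K] [CompactSpace K]
    [TopologicalSpace Y] {l : Filter X} {g : X → C(K, Y)} {y : Y}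
    (hg : Tendsto g l (𝓝 (ContinuousMap.const K y))) {q : Y → Prop} (hq : ∀ᶠ z in 𝓝 y, q z) :
    ∀ᶠ x in l, ∀ t, q (g x t) := by
  obtain ⟨U, hU, hUo, hyU⟩ := eventually_nhds_iff.1 hq
  filter_upwards [hg.eventually (ContinuousMap.eventually_mapsTo isCompact_univ hUo
    fun _ _ ↦ hyU)] with x hx t
  exact hU _ (hx (mem_univ t))

/-- **Frobenius theorem** for the total differential equation `dG = S(G)`, in the form of smooth
dependence of the solution on its initial value. -/
theorem exists_integral_of_symmetric [CompleteSpace E] [CompleteSpace F] {S : E → F →L[ℝ] E}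
    (hS : ContDiff ℝ ∞ S) {e₀ : E}
    (hsymm : ∀ᶠ e in 𝓝 e₀, ∀ x y, fderiv ℝ S e (S e x) y = fderiv ℝ S e (S e y) x) :
    ∃ G : E × F → E, (∀ᶠ a in 𝓝 e₀, G (a, 0) = a) ∧ ∀ᶠ p in 𝓝 (e₀, 0), ContDiffAt ℝ ∞ G p ∧
      ∀ η, fderiv ℝ G p (0, η) = S (G p) η := by
  let T : C(E, F →L[ℝ] E) := ⟨S, hS.continuous⟩
  obtain ⟨g, hg₀, hg⟩ := exists_smooth_path (S := T) hS e₀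
  let ev : C(I, E) →L[ℝ] E := ContinuousMap.evalCLM ℝ (1 : I)
  have hnear : ∀ᶠ p in 𝓝 (e₀, (0 : F)), ∀ t x y,
      fderiv ℝ S (g p t) (S (g p t) x) y = fderiv ℝ S (g p t) (S (g p t) y) x := by
    refine eventually_forall_apply ?_ hsymm
    have := hg.self_of_nhds.1.continuousAt.tendsto
    rwa [hg₀] at this
  refine ⟨fun p ↦ g p 1, ?_, ?_⟩
  · have hincl : Tendsto (fun a : E ↦ (a, (0 : F))) (𝓝 e₀) (𝓝 (e₀, 0)) :=
      (Continuous.prodMk_left (0 : F)).tendsto e₀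
    filter_upwards [hincl.eventually hg] with a ⟨_, hzero, _⟩
    have h1 : g (a, 0) 1 - a - _ = 0 := DFunLike.congr_fun hzero 1
    simpa [sub_eq_zero] using h1
  · filter_upwards [hg, hg.eventually_nhds, hnear] with p ⟨hsmooth, _, hinj⟩ hnhds hsymm'
    refine ⟨ev.contDiff.contDiffAt.comp p hsmooth, fun η ↦ ?_⟩
    have hdiff : DifferentiableAt ℝ g p := hsmooth.differentiableAt (by simp)
    have hG : HasFDerivAt (fun p ↦ g p 1) (ev ∘L fderiv ℝ g p) p :=
      ev.hasFDerivAt.comp p hdiff.hasFDerivAt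
    have h1 := fderiv_path_apply (S := T) hS hdiff (hnhds.mono fun q hq ↦ hq.2.1) hinj hsymm' η 1
    rw [hG.fderiv]
    exact h1.trans (one_smul ℝ _)

end PathEquation

section LocalDiffeomorphism

variable {X Y : Type*} [NormedAddCommGroup X] [NormedSpace ℝ X] [CompleteSpace X]
  [NormedAddCommGroup Y] [NormedSpace ℝ Y]

theorem exists_openPartialHomeomorph_of_isInvertible {Φ : X → Y} {x₀ : X}
    (hΦ : ∀ᶠ x in 𝓝 x₀, ContDiffAt ℝ ∞ Φ x) (hinv : (fderiv ℝ Φ x₀).IsInvertible)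
    {q : X → Prop} (hq : ∀ᶠ x in 𝓝 x₀, q x) :
    ∃ Θ : OpenPartialHomeomorph X Y, (Θ : X → Y) = Φ ∧ x₀ ∈ Θ.source ∧
      (∀ x ∈ Θ.source, q x ∧ (fderiv ℝ Θ x).IsInvertible) ∧ ContDiffOn ℝ ∞ Θ Θ.source ∧
      ContDiffOn ℝ ∞ Θ.symm Θ.target := by
  have hΦ₀ : ContDiffAt ℝ ∞ Φ x₀ := hΦ.self_of_nhds
  have hinv' : ∀ᶠ x in 𝓝 x₀, (fderiv ℝ Φ x).IsInvertible :=
    (hΦ₀.fderiv_right (m := 0) (by simp)).continuousAt.eventually_mem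
      (isOpen_isInvertible.mem_nhds hinv)
  obtain ⟨s, hs, hso, hx₀s⟩ := eventually_nhds_iff.1 (hΦ.and (hinv'.and hq))
  obtain ⟨A, hA⟩ := hinv
  have hA' : HasFDerivAt Φ (A : X →L[ℝ] Y) x₀ :=
    hA ▸ (hΦ₀.differentiableAt (by simp)).hasFDerivAt
  let Θ := (hΦ₀.toOpenPartialHomeomorph Φ hA' (by simp)).restrOpen s hso
  refine ⟨Θ, rfl, ⟨hΦ₀.mem_toOpenPartialHomeomorph_source hA' _, hx₀s⟩,
    fun x hx ↦ ⟨(hs x hx.2).2.2, (hs x hx.2).2.1⟩,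
    fun x hx ↦ (hs x hx.2).1.contDiffWithinAt, fun y hy ↦ ?_⟩
  obtain ⟨hsmooth, ⟨B, hB⟩, -⟩ := hs _ (Θ.map_target hy).2
  exact (Θ.contDiffAt_symm hy (hB ▸ (hsmooth.differentiableAt (by simp)).hasFDerivAt)
    hsmooth).contDiffWithinAt

end LocalDiffeomorphism

section Intertwiner

variable {R : Type*} [Ring R]

/-- Kato's intertwiner of two projectors, which conjugates them when it is invertible. -/
def intertwiner (p q : R) : R := p * q + (1 - p) * (1 - q)

variable {p q : R}

theorem mul_intertwiner (hp : IsIdempotentElem p) : p * intertwiner p q = p * q := by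
  rw [intertwiner, mul_add, ← mul_assoc, hp.eq, ← mul_assoc, hp.mul_one_sub_self, zero_mul,
    add_zero]

theorem intertwiner_mul (hq : IsIdempotentElem q) : intertwiner p q * q = p * q := by
  rw [intertwiner, add_mul, mul_assoc, hq.eq, mul_assoc, hq.one_sub_mul_self, mul_zero, add_zero]

theorem intertwiner_self (hp : IsIdempotentElem p) : intertwiner p p = 1 := by
  rw [intertwiner, hp.eq, hp.one_sub.eq, add_sub_cancel]

theorem inverse_intertwiner_mul (hp : IsIdempotentElem p) (hq : IsIdempotentElem q)
    (hu : IsUnit (intertwiner p q)) :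
    Ring.inverse (intertwiner p q) * p = q * Ring.inverse (intertwiner p q) := by
  rw [← Ring.inverse_mul_cancel_left _ (q * Ring.inverse (intertwiner p q)) hu, ← mul_assoc _ q,
    intertwiner_mul hq, ← mul_intertwiner hp, Ring.mul_inverse_cancel_right _ _ hu]

end Intertwiner

section FlatCoordinates

theorem exists_straightening {E : Type u} [NormedAddCommGroup E] [NormedSpace ℝ E]
    [CompleteSpace E] {S : E → E →L[ℝ] E} (hS : ContDiff ℝ ∞ S) {P : E →L[ℝ] E}
    (hP : IsIdempotentElem P) {e₀ : E} (hSP : S e₀ * P = P)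
    (hsymm : ∀ᶠ e in 𝓝 e₀, ∀ x y, fderiv ℝ S e (S e x) y = fderiv ℝ S e (S e y) x) :
    ∃ Φ : E → E, Φ e₀ = e₀ ∧ fderiv ℝ Φ e₀ = .id ℝ E ∧ ∀ᶠ u in 𝓝 e₀, ContDiffAt ℝ ∞ Φ u ∧
      ∀ x, fderiv ℝ Φ u (P x) = S (Φ u) (P x) := by
  obtain ⟨G, hG₀, hG⟩ := exists_integral_of_symmetric hS hsymm
  let ι : E → E × E := fun u ↦ (u - P (u - e₀), P (u - e₀))
  have hι (u : E) : HasFDerivAt ι ((.id ℝ E - P).prod P) u :=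
    have hPu : HasFDerivAt (fun u ↦ P (u - e₀)) P u :=
      P.hasFDerivAt.comp u ((hasFDerivAt_id u).sub_const e₀)
    ((hasFDerivAt_id u).sub hPu).prodMk hPu
  have hι₀ : ι e₀ = (e₀, 0) := by simp [ι]
  have hPP (x : E) : P (P x) = P x := DFunLike.congr_fun hP x
  have hΦ {u : E} (hu : ContDiffAt ℝ ∞ G (ι u)) (x : E) :
      fderiv ℝ (G ∘ ι) u x = fderiv ℝ G (ι u) (x - P x, P x) := by
    rw [((hu.differentiableAt (by simp)).hasFDerivAt.comp u (hι u)).fderiv]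
    rfl
  have hGι : ContDiffAt ℝ ∞ G (ι e₀) := by rw [hι₀]; exact hG.self_of_nhds.1
  have hG₀' (a : E) : fderiv ℝ G (e₀, 0) (a, 0) = a := by
    have hG' : HasFDerivAt G (fderiv ℝ G (e₀, 0)) (e₀, 0) :=
      (hG.self_of_nhds.1.differentiableAt (by simp)).hasFDerivAt
    have h := (hG'.comp e₀ (hasFDerivAt_prodMk_left e₀ (0 : E))).unique
      ((hasFDerivAt_id e₀).congr_of_eventuallyEq hG₀)
    exact DFunLike.congr_fun h a
  have hιc : Tendsto ι (𝓝 e₀) (𝓝 (e₀, 0)) := hι₀ ▸ (hι e₀).continuousAt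
  refine ⟨G ∘ ι, by simp [hι₀, hG₀.self_of_nhds], ?_, ?_⟩
  · ext x
    have hsplit : ((x - P x, P x) : E × E) = (x - P x, 0) + (0, P x) := by simp
    have hSPx : S e₀ (P x) = P x := DFunLike.congr_fun hSP x
    rw [hΦ hGι, hι₀, hsplit, map_add, hG₀', hG.self_of_nhds.2, hG₀.self_of_nhds, hSPx]
    simp
  · filter_upwards [hιc.eventually hG] with u ⟨hu, hu'⟩
    refine ⟨hu.comp u ?_, fun x ↦ ?_⟩
    · fun_prop
    · rw [hΦ hu, hPP, sub_self, hu', Function.comp_apply]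

variable {E : Type u} [NormedAddCommGroup E] [NormedSpace ℝ E]

theorem exists_projector_with_fixed_ker [CompleteSpace E] {P : E → E →L[ℝ] E} {e₀ : E}
    (hP : ∀ᶠ e in 𝓝 e₀, ContDiffAt ℝ ∞ P e) (hidem : ∀ᶠ e in 𝓝 e₀, IsIdempotentElem (P e)) :
    ∃ S : E → E →L[ℝ] E, ∀ᶠ e in 𝓝 e₀, ContDiffAt ℝ ∞ S e ∧
      P e * S e = S e ∧ S e * P e = P e ∧ P e₀ * S e = P e₀ ∧ S e * P e₀ = S e := by
  have hP₀ : IsIdempotentElem (P e₀) := hidem.self_of_nhds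
  let A : E → E →L[ℝ] E := fun e ↦ intertwiner (P e₀) (P e)
  have hA : ∀ᶠ e in 𝓝 e₀, ContDiffAt ℝ ∞ A e := hP.mono fun e he ↦
    (contDiffAt_const.mul he).add (contDiffAt_const.mul (contDiffAt_const.sub he))
  have hunit : ∀ᶠ e in 𝓝 e₀, IsUnit (A e) :=
    hA.self_of_nhds.continuousAt.eventually_mem
      (Units.isOpen.mem_nhds (by simp [A, intertwiner_self hP₀]))
  refine ⟨fun e ↦ Ring.inverse (A e) * P e₀, ?_⟩
  filter_upwards [hA, hidem, hunit] with e hAe hPe hu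
  have hS := inverse_intertwiner_mul hP₀ hPe hu
  refine ⟨?_, ?_, ?_, ?_, ?_⟩
  · obtain ⟨B, hB⟩ := hu
    have hinv : ContDiffAt ℝ ∞ Ring.inverse (A e) := hB ▸ contDiffAt_ringInverse ℝ B
    exact (hinv.comp e hAe).mul contDiffAt_const
  · rw [hS, ← mul_assoc, hPe.eq]
  · rw [mul_assoc, ← intertwiner_mul hPe, Ring.inverse_mul_cancel_left _ _ hu]
  · rw [hS, ← mul_assoc, ← mul_intertwiner hP₀, Ring.mul_inverse_cancel_right _ _ hu]
  · rw [mul_assoc, hP₀.eq]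

theorem fderiv_symm_of_projector {P S : E → E →L[ℝ] E} {P₀ : E →L[ℝ] E} {e : E}
    (hP : DifferentiableAt ℝ P e) (hS : DifferentiableAt ℝ S e)
    (hPS : ∀ᶠ e' in 𝓝 e, P e' * S e' = S e') (hSP : S e * P e = P e)
    (hP₀S : ∀ᶠ e' in 𝓝 e, P₀ * S e' = P₀) (hSP₀ : S e * P₀ = S e)
    (hsymm : ∀ x y, fderiv ℝ P e (P e x) (P e y) = fderiv ℝ P e (P e y) (P e x)) (x y : E) :
    fderiv ℝ S e (S e x) y = fderiv ℝ S e (S e y) x := by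
  have hleibniz (v z : E) : P e (fderiv ℝ S e v z) + fderiv ℝ P e v (S e z) = fderiv ℝ S e v z := by
    have h := (hP.hasFDerivAt.mul' hS.hasFDerivAt).unique
      (hS.hasFDerivAt.congr_of_eventuallyEq hPS)
    exact DFunLike.congr_fun (DFunLike.congr_fun h v) z
  have hker (v z : E) : P₀ (fderiv ℝ S e v z) = 0 := by
    have h := (hS.hasFDerivAt.const_mul P₀).unique
      ((hasFDerivAt_const P₀ e).congr_of_eventuallyEq hP₀S)
    exact DFunLike.congr_fun (DFunLike.congr_fun h v) z
  have hPSe (z : E) : P e (S e z) = S e z := DFunLike.congr_fun hPS.self_of_nhds z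
  set d := fderiv ℝ S e (S e x) y - fderiv ℝ S e (S e y) x with hd
  have hPd : P e d = d := by
    have h := hsymm (S e x) (S e y)
    simp only [hPSe] at h
    rw [hd, map_sub, eq_sub_of_add_eq (hleibniz (S e x) y),
      eq_sub_of_add_eq (hleibniz (S e y) x), h]
    abel
  have hP₀d : P₀ d = 0 := by rw [hd, map_sub, hker, hker, sub_zero]
  rw [← sub_eq_zero, ← hd]
  calc d = S e (P e d) := by rw [← mul_apply_eq_comp, hSP, hPd]
    _ = S e (P₀ d) := by rw [hPd, ← mul_apply_eq_comp, hSP₀]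
    _ = 0 := by rw [hP₀d, map_zero]

theorem exists_contDiff_eventuallyEq [HasContDiffBump E] {F : Type*} [NormedAddCommGroup F]
    [NormedSpace ℝ F] {f : E → F} {e₀ : E} (hf : ∀ᶠ e in 𝓝 e₀, ContDiffAt ℝ ∞ f e) :
    ∃ g : E → F, ContDiff ℝ ∞ g ∧ g =ᶠ[𝓝 e₀] f := by
  obtain ⟨r, hr, hball⟩ := Metric.nhds_basis_closedBall.eventually_iff.1 hf
  let ρ : ContDiffBump e₀ := ⟨r / 2, r, by positivity, by linarith⟩
  refine ⟨fun e ↦ ρ e • f e, contDiff_iff_contDiffAt.2 fun e ↦ ?_, ?_⟩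
  · by_cases he : e ∈ tsupport ρ
    · exact ρ.contDiffAt.smul (hball (ρ.tsupport_eq ▸ he))
    · refine contDiffAt_const (c := (0 : F)) |>.congr_of_eventuallyEq ?_
      filter_upwards [notMem_tsupport_iff_eventuallyEq.1 he] with x hx
      simp [hx]
  · filter_upwards [ρ.eventuallyEq_one] with e he
    simp [he]

theorem exists_symmetric_field [CompleteSpace E] [HasContDiffBump E] {P : E → E →L[ℝ] E} {e₀ : E}
    (hP : ∀ᶠ e in 𝓝 e₀, ContDiffAt ℝ ∞ P e) (hidem : ∀ᶠ e in 𝓝 e₀, IsIdempotentElem (P e))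
    (hsymm : ∀ᶠ e in 𝓝 e₀, ∀ x y,
      fderiv ℝ P e (P e x) (P e y) = fderiv ℝ P e (P e y) (P e x)) :
    ∃ T : E → E →L[ℝ] E, ContDiff ℝ ∞ T ∧ ∀ᶠ e in 𝓝 e₀,
      P e * T e = T e ∧ T e * P e = P e ∧ T e * P e₀ = T e ∧
        ∀ x y, fderiv ℝ T e (T e x) y = fderiv ℝ T e (T e y) x := by
  obtain ⟨S, hS⟩ := exists_projector_with_fixed_ker hP hidem
  obtain ⟨T, hT, hTS⟩ := exists_contDiff_eventuallyEq (hS.mono fun _ h ↦ h.1)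
  refine ⟨T, hT, ?_⟩
  filter_upwards [hP, hS, hS.eventually_nhds, hsymm, hTS.eventuallyEq_nhds]
    with e hPe ⟨hSe, hPS, hSP, _, hSP₀⟩ hSnear hsymme hTSe
  rw [hTSe.fderiv_eq, hTSe.self_of_nhds]
  exact ⟨hPS, hSP, hSP₀, fderiv_symm_of_projector (hPe.differentiableAt (by simp))
    (hSe.differentiableAt (by simp)) (hSnear.mono fun _ h ↦ h.2.1) hSP
    (hSnear.mono fun _ h ↦ h.2.2.2.1) hSP₀ hsymme⟩

theorem mem_range_iff_symm_apply_mem_range (B : E ≃L[ℝ] E) {P₀ P S : E →L[ℝ] E}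
    (hB : ∀ x, B (P₀ x) = S x) (hPS : P * S = S) (hSP : S * P = P) {w : E} :
    w ∈ P.range ↔ B.symm w ∈ P₀.range := by
  constructor
  · rintro ⟨x, rfl⟩
    exact ⟨P x, B.eq_symm_apply.2 ((hB (P x)).trans (DFunLike.congr_fun hSP x))⟩
  · rintro ⟨x, hx⟩
    have hw : w = S x := by rw [← hB x, ← B.eq_symm_apply.1 hx]; rfl
    exact ⟨S x, by rw [hw]; exact DFunLike.congr_fun hPS x⟩

/-- **Frobenius theorem**, local form; the hypothesis `hsymm` is the involutivity of the range. -/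
theorem exists_flat_coordinates [CompleteSpace E] [HasContDiffBump E] {P : E → E →L[ℝ] E} {e₀ : E}
    (hP : ∀ᶠ e in 𝓝 e₀, ContDiffAt ℝ ∞ P e) (hidem : ∀ᶠ e in 𝓝 e₀, IsIdempotentElem (P e))
    (hsymm : ∀ᶠ e in 𝓝 e₀, ∀ x y,
      fderiv ℝ P e (P e x) (P e y) = fderiv ℝ P e (P e y) (P e x)) :
    ∃ Ψ : OpenPartialHomeomorph E E, e₀ ∈ Ψ.source ∧ ContDiffOn ℝ ∞ Ψ Ψ.source ∧
      ContDiffOn ℝ ∞ Ψ.symm Ψ.target ∧ ∃ W : Submodule ℝ E, ∀ e ∈ Ψ.source, ∀ w,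
        w ∈ (P e).range ↔ fderiv ℝ Ψ e w ∈ W := by
  obtain ⟨T, hT, hPT⟩ := exists_symmetric_field hP hidem hsymm
  obtain ⟨Φ, hΦ₀, hΦ₁, hΦ⟩ := exists_straightening hT hidem.self_of_nhds hPT.self_of_nhds.2.1
    (hPT.mono fun _ h ↦ h.2.2.2)
  have hΦinv : (fderiv ℝ Φ e₀).IsInvertible :=
    hΦ₁ ▸ ContinuousLinearMap.isInvertible_equiv (f := .refl ℝ E)
  have hΦc : Tendsto Φ (𝓝 e₀) (𝓝 e₀) := by
    have := hΦ.self_of_nhds.1.continuousAt.tendsto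
    rwa [hΦ₀] at this
  obtain ⟨Θ, hΘ, hΘ₀, hΘd, hΘs, hΘs'⟩ := exists_openPartialHomeomorph_of_isInvertible
    (hΦ.mono fun _ h ↦ h.1) hΦinv (hΦ.and (hΦc.eventually hPT))
  refine ⟨Θ.symm, ?_, hΘs', hΘs, (P e₀).range, fun e he w ↦ ?_⟩
  · have := Θ.map_source hΘ₀
    rwa [hΘ, hΦ₀] at this
  obtain ⟨⟨⟨-, hΦP⟩, hPS, hSP, hSP₀, -⟩, B, hB⟩ := hΘd _ (Θ.map_target he)
  have hΦe : Φ (Θ.symm e) = e := by rw [← hΘ, Θ.right_inv he]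
  rw [hΦe] at hPS hSP hSP₀ hΦP
  have hBP₀ (x : E) : B (P e₀ x) = T e x :=
    calc B (P e₀ x) = fderiv ℝ Φ (Θ.symm e) (P e₀ x) := by rw [← hΘ, ← hB]; rfl
      _ = T e x := by rw [hΦP, ← mul_apply_eq_comp (T e), hSP₀]
  have hΘsymm : HasFDerivAt Θ.symm (B.symm : E →L[ℝ] E) e := by
    refine Θ.hasFDerivAt_symm he ?_
    rw [hB]
    exact ((hΘs.contDiffAt (Θ.open_source.mem_nhds (Θ.map_target he))).differentiableAt
      (by simp)).hasFDerivAt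
  rw [hΘsymm.fderiv]
  exact mem_range_iff_symm_apply_mem_range B hBP₀ hPS hSP

end FlatCoordinates

end Frobenius

namespace LConn

section Algebra

variable {E : Type*} [NormedAddCommGroup E] [NormedSpace ℝ E]
  {M : Type*} [TopologicalSpace M] [ChartedSpace E M]

theorem lie_swap (X Y : VField E M) : lie X Y = -lie Y X :=
  mlieBracket_swap

theorem lie_zero_left (Y : VField E M) : lie 0 Y = 0 :=
  mlieBracket_zero_left

theorem lie_zero_right (X : VField E M) : lie X 0 = 0 :=
  mlieBracket_zero_right

theorem app_zero (K : VOneForm E M) : app K 0 = 0 :=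
  funext fun z ↦ map_zero (K z)

theorem app_add (K : VOneForm E M) (X Y : VField E M) : app K (X + Y) = app K X + app K Y :=
  funext fun z ↦ map_add (K z) _ _

theorem app_sub (K : VOneForm E M) (X Y : VField E M) : app K (X - Y) = app K X - app K Y :=
  funext fun z ↦ map_sub (K z) _ _

theorem app_smul (K : VOneForm E M) (c : ℝ) (X : VField E M) : app K (c • X) = c • app K X :=
  funext fun z ↦ map_smul (K z) _ _

theorem app_hproj (Γ : VOneForm E M) (X : VField E M) :
    app (hproj Γ) X = (1 / 2 : ℝ) • (X + app Γ X) :=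
  rfl

end Algebra

section Calculus

variable {E : Type*} [NormedAddCommGroup E] [NormedSpace ℝ E]
  {M : Type*} [TopologicalSpace M] [ChartedSpace E M] [IsManifold 𝓘(ℝ, E) ∞ M]
  {K : VOneForm E M} {V W X X' Y Y' : VField E M} {z : M}

theorem SmoothField.mdifferentiableAt (hX : SmoothField X) (z : M) :
    MDifferentiableAt 𝓘(ℝ, E) 𝓘(ℝ, E).tangent
      (fun x ↦ (⟨x, X x⟩ : TangentBundle 𝓘(ℝ, E) M)) z :=
  (hX z).mdifferentiableAt (by simp)

theorem SmoothField.add (hX : SmoothField X) (hY : SmoothField Y) : SmoothField (X + Y) :=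
  fun z ↦ (hX z).add_section (hY z)

theorem SmoothField.sub (hX : SmoothField X) (hY : SmoothField Y) : SmoothField (X - Y) :=
  fun z ↦ (hX z).sub_section (hY z)

theorem SmoothForm.smoothField_app (hK : SmoothForm K) (hX : SmoothField X) :
    SmoothField (app K X) :=
  fun z ↦ ContMDiffAt.clm_bundle_apply (hK z) (hX z)

theorem smoothForm_id :
    SmoothForm (fun z : M ↦ ContinuousLinearMap.id ℝ (TangentSpace 𝓘(ℝ, E) z)) := by
  intro z
  refine (contMDiffAt_hom_bundle _).2 ⟨contMDiffAt_id, ?_⟩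
  refine (contMDiffAt_const (c := ContinuousLinearMap.id ℝ E)).congr_of_eventuallyEq ?_
  have hz := (trivializationAt E (TangentSpace 𝓘(ℝ, E)) z).open_baseSet.mem_nhds
    (FiberBundle.mem_baseSet_trivializationAt' z)
  filter_upwards [hz] with x hx
  rw [ContinuousLinearMap.inCoordinates_eq hx hx]
  ext v
  simp

theorem SmoothForm.hproj {Γ : VOneForm E M} (hΓ : SmoothForm Γ) : SmoothForm (hproj Γ) :=
  fun z ↦ contMDiffAt_const.smul_section ((smoothForm_id z).add_section (hΓ z))

variable [CompleteSpace E]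

theorem lie_add_left (hX : SmoothField X) (hX' : SmoothField X') :
    lie (X + X') Y = lie X Y + lie X' Y :=
  funext fun z ↦ mlieBracket_add_left (hX.mdifferentiableAt z) (hX'.mdifferentiableAt z)

theorem lie_add_right (hY : SmoothField Y) (hY' : SmoothField Y') :
    lie X (Y + Y') = lie X Y + lie X Y' := by
  rw [lie_swap, lie_add_left hY hY', lie_swap Y, lie_swap Y', neg_add, neg_neg, neg_neg]

theorem lie_smul_left (c : ℝ) (hX : SmoothField X) : lie (c • X) Y = c • lie X Y :=
  funext fun z ↦ mlieBracket_const_smul_left (hX.mdifferentiableAt z)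

theorem lie_smul_right (c : ℝ) (hY : SmoothField Y) : lie X (c • Y) = c • lie X Y := by
  rw [lie_swap, lie_smul_left c hY, lie_swap Y, smul_neg, neg_neg]

theorem lie_sub_left (hX : SmoothField X) (hX' : SmoothField X') :
    lie (X - X') Y = lie X Y - lie X' Y :=
  eq_sub_of_add_eq <| by rw [← lie_add_left (hX.sub hX') hX', sub_add_cancel]

theorem lie_sub_right (hY : SmoothField Y) (hY' : SmoothField Y') :
    lie X (Y - Y') = lie X Y - lie X Y' :=
  eq_sub_of_add_eq <| by rw [← lie_add_right (hY.sub hY') hY', sub_add_cancel]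

theorem fnBracket_hproj {Γ : VOneForm E M} (hΓ : SmoothForm Γ) (hX : SmoothField X)
    (hY : SmoothField Y) :
    fnBracket (hproj Γ) (hproj Γ) X Y = (1 / 4 : ℝ) • fnBracket Γ Γ X Y := by
  have hΓX := hΓ.smoothField_app hX
  have hΓY := hΓ.smoothField_app hY
  have hhX := hX.add hΓX
  have hhY := hY.add hΓY
  simp only [fnBracket, app_hproj, lie_smul_left _ hhX, lie_smul_right _ hhY,
    lie_add_left hX hΓX, lie_add_right hY hΓY, app_add, app_smul]
  module

theorem vanishes_nijenhuis_iff_vanishes_curvature {Γ : VOneForm E M} (hΓ : SmoothForm Γ) :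
    Vanishes (nijenhuis Γ) ↔ Vanishes (curvature Γ) := by
  refine forall₄_congr fun X Y hX hY ↦ ?_
  rw [nijenhuis, curvature, fnBracket_hproj hΓ hX hY, neg_eq_zero, smul_smul]
  simp only [smul_eq_zero]
  norm_num

end Calculus

section Projector

variable {E : Type*} [NormedAddCommGroup E] [NormedSpace ℝ E] [CompleteSpace E]
  {M : Type*} [TopologicalSpace M] [ChartedSpace E M] [IsManifold 𝓘(ℝ, E) ∞ M]
  {P : VOneForm E M} {X Y : VField E M}

/-- A distribution `D` is involutive when the Lie bracket of two `C^∞` vector fields with values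
in `D` has values in `D`. -/
def Involutive (D : ∀ z : M, Submodule ℝ (TangentSpace 𝓘(ℝ, E) z)) : Prop :=
  ∀ X Y : VField E M, SmoothField X → SmoothField Y → (∀ z, X z ∈ D z) → (∀ z, Y z ∈ D z) →
    ∀ z, lie X Y z ∈ D z

omit [CompleteSpace E] [IsManifold 𝓘(ℝ, E) ∞ M] in
theorem app_app (hPP : ∀ z, IsIdempotentElem (P z)) (X : VField E M) :
    app P (app P X) = app P X :=
  funext fun z ↦ DFunLike.congr_fun (hPP z) (X z)

theorem fnBracket_self_of_isIdempotentElem (hP : SmoothForm P) (hPP : ∀ z, IsIdempotentElem (P z))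
    (hX : SmoothField X) (hY : SmoothField Y) :
    fnBracket P P X Y = (2 : ℝ) • (lie (app P X) (app P Y) - app P (lie (app P X) (app P Y)) +
      app P (lie (X - app P X) (Y - app P Y))) := by
  have hPX := hP.smoothField_app hX
  have hPY := hP.smoothField_app hY
  simp only [fnBracket, app_app hPP, lie_sub_left hX hPX, lie_sub_right hY hPY, app_add, app_sub]
  module

theorem vanishes_fnBracket_self_iff (hP : SmoothForm P) (hPP : ∀ z, IsIdempotentElem (P z)) :
    Vanishes (fnBracket P P) ↔
      Involutive (fun z ↦ (P z).range) ∧ Involutive (fun z ↦ (P z).ker) := by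
  have hrange (z : M) {ξ : TangentSpace 𝓘(ℝ, E) z} : ξ ∈ (P z).range ↔ P z ξ = ξ :=
    LinearMap.IsIdempotentElem.mem_range_iff
      (ContinuousLinearMap.IsIdempotentElem.toLinearMap (hPP z))
  refine ⟨fun h ↦ ⟨fun X Y hX hY hPX hPY ↦ ?_, fun X Y hX hY hPX hPY ↦ ?_⟩,
    fun ⟨hPrange, hPker⟩ X Y hX hY ↦ ?_⟩
  · have hX' : app P X = X := funext fun z ↦ (hrange z).1 (hPX z)
    have hY' : app P Y = Y := funext fun z ↦ (hrange z).1 (hPY z)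
    have hXY := fnBracket_self_of_isIdempotentElem hP hPP hX hY
    rw [h X Y hX hY, hX', hY', sub_self, lie_zero_left, app_zero, add_zero] at hXY
    have := sub_eq_zero.1 ((smul_eq_zero.1 hXY.symm).resolve_left two_ne_zero)
    exact fun z ↦ (hrange z).2 (congrFun this.symm z)
  · have hX' : app P X = 0 := funext hPX
    have hY' : app P Y = 0 := funext hPY
    have hXY := fnBracket_self_of_isIdempotentElem hP hPP hX hY
    rw [h X Y hX hY, hX', hY', sub_zero, sub_zero, lie_zero_left, app_zero, sub_zero,
      zero_add] at hXY
    exact congrFun ((smul_eq_zero.1 hXY.symm).resolve_left two_ne_zero)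
  · have hPX := hP.smoothField_app hX
    have hPY := hP.smoothField_app hY
    have hker (Z : VField E M) (z : M) : (Z - app P Z) z ∈ (P z).ker :=
      congrFun (show app P (Z - app P Z) = 0 by rw [app_sub, app_app hPP, sub_self]) z
    have h₁ : app P (lie (app P X) (app P Y)) = lie (app P X) (app P Y) := funext fun z ↦
      (hrange z).1 (hPrange _ _ hPX hPY (fun x ↦ ⟨X x, rfl⟩) (fun x ↦ ⟨Y x, rfl⟩) z)
    have h₂ : app P (lie (X - app P X) (Y - app P Y)) = 0 :=
      funext (hPker _ _ (hX.sub hPX) (hY.sub hPY) (hker X) (hker Y))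
    rw [fnBracket_self_of_isIdempotentElem hP hPP hX hY, h₁, h₂, sub_self, add_zero, smul_zero]

end Projector

section Tensorial

variable {E : Type*} [NormedAddCommGroup E] [NormedSpace ℝ E] [CompleteSpace E]
  {M : Type*} [TopologicalSpace M] [ChartedSpace E M] [IsManifold 𝓘(ℝ, E) ∞ M]

/-- The Lie derivative `𝓛_X K` of a vector `1`-form, as the operation `Y ↦ [X, KY] - K[X, Y]`
on vector fields. -/
def lieDeriv (X : VField E M) (K : VOneForm E M) (Y : VField E M) : VField E M :=
  lie X (app K Y) - app K (lie X Y)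

theorem tensorialAt_lieDeriv {K : VOneForm E M} (hK : SmoothForm K) (X : VField E M) (z : M) :
    TensorialAt 𝓘(ℝ, E) E (fun Y ↦ lieDeriv X K Y z) z := by
  have hKY {Y : VField E M} (hY : MDifferentiableAt 𝓘(ℝ, E) 𝓘(ℝ, E).tangent
      (fun x ↦ (⟨x, Y x⟩ : TangentBundle 𝓘(ℝ, E) M)) z) :
      MDifferentiableAt 𝓘(ℝ, E) 𝓘(ℝ, E).tangent
        (fun x ↦ (⟨x, app K Y x⟩ : TangentBundle 𝓘(ℝ, E) M)) z :=
    ((hK z).mdifferentiableAt (by simp)).clm_bundle_apply hY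
  constructor
  · intro f Y hf hY
    have h : app K (f • Y) = f • app K Y := funext fun x ↦ map_smul (K x) (f x) (Y x)
    simp only [lieDeriv, lie, h, Pi.sub_apply]
    rw [mlieBracket_smul_right hf (hKY hY)]
    simp only [app, mlieBracket_smul_right hf hY, map_add, map_smul]
    module
  · intro Y Y' hY hY'
    simp only [lieDeriv, lie, app_add, Pi.sub_apply]
    rw [mlieBracket_add_right (hKY hY) (hKY hY')]
    simp only [app, mlieBracket_add_right hY hY', map_add]
    module

end Tensorial

section Extension

variable {E : Type*} [NormedAddCommGroup E] [NormedSpace ℝ E] [FiniteDimensional ℝ E]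
  {M : Type*} [TopologicalSpace M] [ChartedSpace E M] [IsManifold 𝓘(ℝ, E) ∞ M] [T2Space M]

theorem exists_smoothField_eq (z : M) (ξ : TangentSpace 𝓘(ℝ, E) z) :
    ∃ X : VField E M, SmoothField X ∧ X z = ξ := by
  obtain ⟨s, hs, hξ⟩ := FiberBundle.exists_contMDiffOn_extend (k := ∞) 𝓘(ℝ, E) E ξ
  obtain ⟨ρ, -, hρ⟩ := (SmoothBumpFunction.nhds_basis_tsupport (I := 𝓘(ℝ, E)) z).mem_iff.1
    (interior_mem_nhds.2 hs)
  refine ⟨fun x ↦ ρ x • FiberBundle.extend E ξ x, ?_, by simp⟩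
  exact ContMDiffOn.smul_section_of_tsupport ρ.contMDiff.contMDiffOn isOpen_interior hρ
    (hξ.mono interior_subset)

end Extension

section LConnection

variable {E : Type*} [NormedAddCommGroup E] [NormedSpace ℝ E]
  {M : Type*} [TopologicalSpace M] [ChartedSpace E M] [IsManifold 𝓘(ℝ, E) ∞ M]
  {n : ℕ} {L Γ : VOneForm E M}

theorem IsTangentStructure.app_app (hL : IsTangentStructure n L) (X : VField E M) :
    app L (app L X) = 0 :=
  funext fun z ↦ show L z (X z) ∈ (L z).ker from hL.range_eq_ker z ▸ ⟨X z, rfl⟩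

theorem IsLConnection.apply_apply (hΓ : IsLConnection L Γ) (z : M)
    (ξ : TangentSpace 𝓘(ℝ, E) z) : L z (Γ z ξ) = L z ξ :=
  DFunLike.congr_fun (hΓ.comp_left z) ξ

theorem IsLConnection.apply_eq_neg (hΓ : IsLConnection L Γ) (hL : IsTangentStructure n L) {z : M}
    {ξ : TangentSpace 𝓘(ℝ, E) z} (hξ : L z ξ = 0) : Γ z ξ = -ξ := by
  obtain ⟨η, rfl⟩ : ξ ∈ (L z).range := hL.range_eq_ker z ▸ hξ
  exact DFunLike.congr_fun (hΓ.comp_right z) η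

theorem IsLConnection.comp_self (hΓ : IsLConnection L Γ) (hL : IsTangentStructure n L) (z : M) :
    (Γ z).comp (Γ z) = ContinuousLinearMap.id ℝ (TangentSpace 𝓘(ℝ, E) z) := by
  ext ξ
  have h : L z (Γ z ξ - ξ) = 0 := by rw [map_sub, hΓ.apply_apply, sub_self]
  have h' := hΓ.apply_eq_neg hL h
  rw [map_sub, neg_sub, sub_left_inj] at h'
  exact h'

theorem IsLConnection.ker_hproj (hΓ : IsLConnection L Γ) (hL : IsTangentStructure n L) (z : M) :
    (hproj Γ z).ker = (L z).ker := by
  ext ξ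
  refine ⟨fun h ↦ ?_, fun h ↦ ?_⟩
  · have h' : L z (hproj Γ z ξ) = L z ξ := by
      change L z ((1 / 2 : ℝ) • (ξ + Γ z ξ)) = L z ξ
      rw [map_smul, map_add, hΓ.apply_apply]
      module
    exact h'.symm.trans ((congrArg (L z) h).trans (map_zero (L z)))
  · change (1 / 2 : ℝ) • (ξ + Γ z ξ) = 0
    rw [hΓ.apply_eq_neg hL h, add_neg_cancel, smul_zero]

theorem IsTangentStructure.app_lie_app (hL : IsTangentStructure n L) {A U : VField E M}
    (hA : SmoothField A) (hU : SmoothField U) (hLU : app L U = 0) :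
    app L (lie U (app L A)) = 0 := by
  have h := hL.nijenhuis_eq_zero U A hU hA
  simp only [nijenhuis, fnBracket, hLU, lie_zero_left, hL.app_app, zero_add] at h
  linear_combination (norm := module) (-1 : ℝ) • h

end LConnection

section Vertical

variable {E : Type*} [NormedAddCommGroup E] [NormedSpace ℝ E] [FiniteDimensional ℝ E]
  {M : Type*} [TopologicalSpace M] [ChartedSpace E M] [IsManifold 𝓘(ℝ, E) ∞ M] [T2Space M]
  {n : ℕ} {L : VOneForm E M}

theorem IsTangentStructure.involutive_ker (hL : IsTangentStructure n L) :
    Involutive (fun z ↦ (L z).ker) := by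
  intro X Y hX hY hLX hLY z
  have : CompleteSpace E := FiniteDimensional.complete ℝ E
  obtain ⟨ξ, hξ⟩ : Y z ∈ (L z).range := hL.range_eq_ker z ▸ hLY z
  obtain ⟨A, hA, rfl⟩ := exists_smoothField_eq z ξ
  have hLA := hL.smooth.smoothField_app hA
  have hYA : lieDeriv X L Y z = lieDeriv X L (app L A) z :=
    (tensorialAt_lieDeriv hL.smooth X z).pointwise (hY.mdifferentiableAt z)
      (hLA.mdifferentiableAt z) hξ.symm
  have hLY' : app L Y = 0 := funext hLY
  rw [lieDeriv, lieDeriv, hL.app_app, hLY', hL.app_lie_app hA hX (funext hLX), lie_zero_right,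
    sub_zero, zero_sub] at hYA
  exact neg_eq_zero.1 hYA

end Vertical

section Model

variable {E : Type*} [NormedAddCommGroup E] [NormedSpace ℝ E] {P : E → E →L[ℝ] E} {X Y : E → E}
  {e : E}

theorem mlieBracket_eq_lieBracket (X Y : ∀ x : E, TangentSpace 𝓘(ℝ, E) x) (e : E) :
    mlieBracket 𝓘(ℝ, E) X Y e = lieBracket ℝ (X : E → E) (Y : E → E) e := by
  have h := congrFun (mlieBracketWithin_eq_lieBracketWithin (V := X) (W := Y) (s := univ)) e
  rw [mlieBracketWithin_univ] at h
  exact h.trans (congrFun (lieBracketWithin_univ (𝕜 := ℝ) (V := X) (W := Y)) e)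

theorem fderiv_apply_mem {f : E → E} {W : Submodule ℝ E} (hW : IsClosed (W : Set E))
    (hf : ∀ᶠ x in 𝓝 e, f x ∈ W) (v : E) : fderiv ℝ f e v ∈ W := by
  by_cases hd : DifferentiableAt ℝ f e
  swap
  · simp [fderiv_zero_of_not_differentiableAt hd]
  have ht : Tendsto (fun c : ℝ ↦ e + c⁻¹ • v) atTop (𝓝 e) := by
    have h := (tendsto_inv_atTop_zero (𝕜 := ℝ)).smul_const v
    simpa using h.const_add e
  refine hW.mem_of_tendsto (hd.hasFDerivAt.lim_real v) ?_
  filter_upwards [ht.eventually hf] with c hc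
  exact W.smul_mem c (W.sub_mem hc hf.self_of_nhds)

theorem lieBracket_mem {W : Submodule ℝ E} (hW : IsClosed (W : Set E))
    (hX : ∀ᶠ x in 𝓝 e, X x ∈ W) (hY : ∀ᶠ x in 𝓝 e, Y x ∈ W) : lieBracket ℝ X Y e ∈ W :=
  W.sub_mem (fderiv_apply_mem hW hY _) (fderiv_apply_mem hW hX _)

theorem apply_fderiv_apply_apply_eq_zero (hP : DifferentiableAt ℝ P e)
    (hPP : ∀ᶠ e' in 𝓝 e, IsIdempotentElem (P e')) (v w : E) :
    P e (fderiv ℝ P e v (P e w)) = 0 := by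
  have hderiv := hP.hasFDerivAt.unique ((hP.hasFDerivAt.mul' hP.hasFDerivAt).congr_of_eventuallyEq
    (hPP.mono fun _ h ↦ h.eq.symm))
  have h : fderiv ℝ P e v (P e w) =
      P e (fderiv ℝ P e v (P e w)) + fderiv ℝ P e v (P e (P e w)) :=
    DFunLike.congr_fun (DFunLike.congr_fun hderiv v) (P e w)
  have hPPw : P e (P e w) = P e w := DFunLike.congr_fun hPP.self_of_nhds w
  rw [hPPw] at h
  exact right_eq_add.1 h

theorem fderiv_apply_comm_of_apply_lieBracket_eq (hP : DifferentiableAt ℝ P e)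
    (hPP : ∀ᶠ e' in 𝓝 e, IsIdempotentElem (P e')) (hX : DifferentiableAt ℝ X e)
    (hY : DifferentiableAt ℝ Y e) (hPX : P e (X e) = X e) (hPY : P e (Y e) = Y e)
    (h : P e (lieBracket ℝ (fun x ↦ P x (X x)) (fun x ↦ P x (Y x)) e) =
      lieBracket ℝ (fun x ↦ P x (X x)) (fun x ↦ P x (Y x)) e) :
    fderiv ℝ P e (X e) (Y e) = fderiv ℝ P e (Y e) (X e) := by
  have hPP' (v : E) : P e (P e v) = P e v := DFunLike.congr_fun hPP.self_of_nhds v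
  have hPdP (v w : E) (hw : P e w = w) : P e (fderiv ℝ P e v w) = 0 := by
    rw [← hw, apply_fderiv_apply_apply_eq_zero hP hPP]
  simp only [lieBracket, fderiv_clm_apply hP hX, fderiv_clm_apply hP hY, hPX, hPY, add_apply,
    ContinuousLinearMap.comp_apply, ContinuousLinearMap.flip_apply, map_add, map_sub, hPP',
    hPdP _ _ hPX, hPdP _ _ hPY] at h
  linear_combination (norm := module) -h

end Model

section Chart

variable {E : Type*} [NormedAddCommGroup E] [NormedSpace ℝ E]
  {M : Type*} [TopologicalSpace M] [ChartedSpace E M]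

/-- The coordinate expression of a vector field in a chart. -/
def coordField (φ : OpenPartialHomeomorph M E) (X : VField E M) : E → E :=
  mpullback 𝓘(ℝ, E) 𝓘(ℝ, E) φ.symm X

/-- The coordinate expression of a vector `1`-form in a chart. -/
def coordForm (φ : OpenPartialHomeomorph M E) (K : VOneForm E M) (e : E) : E →L[ℝ] E :=
  (mfderiv 𝓘(ℝ, E) 𝓘(ℝ, E) φ (φ.symm e)).comp
    ((K (φ.symm e)).comp (mfderiv 𝓘(ℝ, E) 𝓘(ℝ, E) φ.symm e))

/-- The vector field with constant components `v` in a chart. -/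
def constField (φ : OpenPartialHomeomorph M E) (v : E) : VField E M :=
  mpullback 𝓘(ℝ, E) 𝓘(ℝ, E) φ fun _ ↦ v

variable {φ : OpenPartialHomeomorph M E} (hφ : φ ∈ IsManifold.maximalAtlas 𝓘(ℝ, E) ∞ M)
  {K : VOneForm E M} {X Y : VField E M} {e : E} {z : M}
include hφ

theorem mdifferentiable_of_mem_maximalAtlas : φ.MDifferentiable 𝓘(ℝ, E) 𝓘(ℝ, E) :=
  ⟨(contMDiffOn_of_mem_maximalAtlas hφ).mdifferentiableOn (by simp),
    (contMDiffOn_symm_of_mem_maximalAtlas hφ).mdifferentiableOn (by simp)⟩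

theorem isInvertible_mfderiv (hz : z ∈ φ.source) :
    (mfderiv 𝓘(ℝ, E) 𝓘(ℝ, E) φ z).IsInvertible :=
  ⟨(mdifferentiable_of_mem_maximalAtlas hφ).mfderiv hz, rfl⟩

theorem isInvertible_mfderiv_symm (he : e ∈ φ.target) :
    (mfderiv 𝓘(ℝ, E) 𝓘(ℝ, E) φ.symm e).IsInvertible :=
  ⟨(mdifferentiable_of_mem_maximalAtlas hφ).symm.mfderiv he, rfl⟩

theorem mfderiv_mfderiv_symm (he : e ∈ φ.target) (v : E) :
    mfderiv 𝓘(ℝ, E) 𝓘(ℝ, E) φ (φ.symm e) (mfderiv 𝓘(ℝ, E) 𝓘(ℝ, E) φ.symm e v) = v :=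
  DFunLike.congr_fun ((mdifferentiable_of_mem_maximalAtlas hφ).comp_symm_deriv he) v

theorem mfderiv_symm_mfderiv (he : e ∈ φ.target) (ξ : TangentSpace 𝓘(ℝ, E) (φ.symm e)) :
    mfderiv 𝓘(ℝ, E) 𝓘(ℝ, E) φ.symm e (mfderiv 𝓘(ℝ, E) 𝓘(ℝ, E) φ (φ.symm e) ξ) = ξ := by
  have h := (mdifferentiable_of_mem_maximalAtlas hφ).symm_comp_deriv (φ.map_target he)
  rw [φ.right_inv he] at h
  exact DFunLike.congr_fun h ξ

theorem coordField_apply (he : e ∈ φ.target) :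
    coordField φ X e = mfderiv 𝓘(ℝ, E) 𝓘(ℝ, E) φ (φ.symm e) (X (φ.symm e)) := by
  have hinv : (mfderiv 𝓘(ℝ, E) 𝓘(ℝ, E) φ.symm e).inverse =
      mfderiv 𝓘(ℝ, E) 𝓘(ℝ, E) φ (φ.symm e) :=
    ContinuousLinearMap.inverse_eq (by ext v; exact mfderiv_symm_mfderiv hφ he v)
      (by ext v; exact mfderiv_mfderiv_symm hφ he v)
  exact DFunLike.congr_fun hinv (X (φ.symm e))

theorem coordField_constField (he : e ∈ φ.target) (v : E) :
    coordField φ (constField φ v) e = v := by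
  rw [coordField_apply hφ he]
  exact (isInvertible_mfderiv hφ (φ.map_target he)).self_apply_inverse v

theorem coordForm_mfderiv (he : e ∈ φ.target) (ξ : TangentSpace 𝓘(ℝ, E) (φ.symm e)) :
    coordForm φ K e (mfderiv 𝓘(ℝ, E) 𝓘(ℝ, E) φ (φ.symm e) ξ) =
      mfderiv 𝓘(ℝ, E) 𝓘(ℝ, E) φ (φ.symm e) (K (φ.symm e) ξ) :=
  congrArg (fun η ↦ mfderiv 𝓘(ℝ, E) 𝓘(ℝ, E) φ (φ.symm e) (K (φ.symm e) η))
    (mfderiv_symm_mfderiv hφ he ξ)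

theorem coordField_app (he : e ∈ φ.target) :
    coordField φ (app K X) e = coordForm φ K e (coordField φ X e) := by
  rw [coordField_apply hφ he, coordField_apply hφ he, coordForm_mfderiv hφ he]
  rfl

theorem isIdempotentElem_coordForm (hK : ∀ z, IsIdempotentElem (K z)) (he : e ∈ φ.target) :
    IsIdempotentElem (coordForm φ K e) := by
  refine ContinuousLinearMap.ext fun v ↦ (coordForm_mfderiv hφ he _).trans ?_
  exact congrArg _ (DFunLike.congr_fun (hK (φ.symm e)) _)

theorem mem_range_coordForm_iff (he : e ∈ φ.target) (ξ : TangentSpace 𝓘(ℝ, E) (φ.symm e)) :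
    mfderiv 𝓘(ℝ, E) 𝓘(ℝ, E) φ (φ.symm e) ξ ∈ (coordForm φ K e).range ↔
      ξ ∈ (K (φ.symm e)).range := by
  constructor
  · rintro ⟨v, hv⟩
    refine ⟨mfderiv 𝓘(ℝ, E) 𝓘(ℝ, E) φ.symm e v, ?_⟩
    exact (mdifferentiable_of_mem_maximalAtlas hφ).mfderiv_injective (φ.map_target he) hv
  · rintro ⟨η, rfl⟩
    exact ⟨_, coordForm_mfderiv hφ he η⟩

theorem trans_mem_maximalAtlas {Ψ : OpenPartialHomeomorph E E}
    (hΨ : ContDiffOn ℝ ∞ Ψ Ψ.source) (hΨ' : ContDiffOn ℝ ∞ Ψ.symm Ψ.target) :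
    φ.trans Ψ ∈ IsManifold.maximalAtlas 𝓘(ℝ, E) ∞ M := by
  have hG : Ψ ∈ contDiffGroupoid ∞ 𝓘(ℝ, E) := by
    rw [contDiffGroupoid, mem_groupoid_of_pregroupoid]
    simpa [contDiffPregroupoid] using And.intro hΨ hΨ'
  rw [IsManifold.mem_maximalAtlas_iff] at hφ ⊢
  intro e' he'
  obtain ⟨h1, h2⟩ := hφ e' he'
  constructor
  · rw [OpenPartialHomeomorph.trans_symm_eq_symm_trans_symm, OpenPartialHomeomorph.trans_assoc]
    exact StructureGroupoid.trans _ (StructureGroupoid.symm _ hG) h1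
  · rw [← OpenPartialHomeomorph.trans_assoc]
    exact StructureGroupoid.trans _ h2 hG

variable [IsManifold 𝓘(ℝ, E) ∞ M]

theorem contDiffAt_coordField [CompleteSpace E] (he : e ∈ φ.target)
    (hX : ContMDiffAt 𝓘(ℝ, E) 𝓘(ℝ, E).tangent ∞
      (fun x ↦ (⟨x, X x⟩ : TangentBundle 𝓘(ℝ, E) M)) (φ.symm e)) :
    ContDiffAt ℝ ∞ (coordField φ X) e :=
  contMDiffAt_vectorSpace_iff_contDiffAt.1 <|
    ContMDiffAt.mpullback_vectorField_preimage hX (contMDiffAt_symm_of_mem_maximalAtlas hφ he)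
      (isInvertible_mfderiv_symm hφ he) (by simp)

theorem coordField_lie [CompleteSpace E] (hX : SmoothField X)
    (hY : SmoothField Y) (he : e ∈ φ.target) :
    coordField φ (lie X Y) e = lieBracket ℝ (coordField φ X) (coordField φ Y) e := by
  have hmin : minSmoothness ℝ 2 ≤ ∞ := by
    simpa using (WithTop.coe_le_coe.2 le_top : ((2 : ℕ∞) : WithTop ℕ∞) ≤ ∞)
  have : IsManifold 𝓘(ℝ, E) (minSmoothness ℝ 2) M := .of_le (n := ∞) hmin
  exact (mpullback_mlieBracket (hX.mdifferentiableAt _) (hY.mdifferentiableAt _)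
    (contMDiffAt_symm_of_mem_maximalAtlas hφ he) hmin).trans (mlieBracket_eq_lieBracket _ _ e)

theorem contMDiffAt_constField [CompleteSpace E] (v : E) (hz : z ∈ φ.source) :
    ContMDiffAt 𝓘(ℝ, E) 𝓘(ℝ, E).tangent ∞
      (fun x ↦ (⟨x, constField φ v x⟩ : TangentBundle 𝓘(ℝ, E) M)) z :=
  ContMDiffAt.mpullback_vectorField_preimage
    (contMDiffAt_vectorSpace_iff_contDiffAt.2 contDiffAt_const)
    (contMDiffAt_of_mem_maximalAtlas hφ hz) (isInvertible_mfderiv hφ hz) (by simp)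

theorem contDiffOn_coordForm [FiniteDimensional ℝ E] (hK : SmoothForm K) :
    ContDiffOn ℝ ∞ (coordForm φ K) φ.target := by
  have : CompleteSpace E := FiniteDimensional.complete ℝ E
  refine contDiffOn_clm_apply.2 fun v e he ↦ ContDiffAt.contDiffWithinAt ?_
  have hv := ContMDiffAt.clm_bundle_apply (hK (φ.symm e))
    (contMDiffAt_constField hφ v (φ.map_target he))
  refine (contDiffAt_coordField hφ he hv).congr_of_eventuallyEq ?_
  filter_upwards [φ.open_target.mem_nhds he] with x hx
  exact ((coordField_app hφ hx).trans (by rw [coordField_constField hφ hx])).symm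

end Chart

section Integrability

variable {E : Type*} [NormedAddCommGroup E] [NormedSpace ℝ E] [FiniteDimensional ℝ E]
  {M : Type*} [TopologicalSpace M] [ChartedSpace E M] [IsManifold 𝓘(ℝ, E) ∞ M]

theorem CompletelyIntegrable.involutive {D : ∀ z : M, Submodule ℝ (TangentSpace 𝓘(ℝ, E) z)}
    (hD : CompletelyIntegrable D) : Involutive D := by
  intro X Y hX hY hXD hYD z
  have : CompleteSpace E := FiniteDimensional.complete ℝ E
  obtain ⟨φ, hφ, hz, W, hW⟩ := hD z
  obtain ⟨e, he, rfl⟩ : ∃ e ∈ φ.target, φ.symm e = z := ⟨φ z, φ.map_source hz, φ.left_inv hz⟩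
  have hcoord {U : VField E M} (hU : ∀ z, U z ∈ D z) : ∀ᶠ x in 𝓝 e, coordField φ U x ∈ W := by
    filter_upwards [φ.open_target.mem_nhds he] with x hx
    rw [coordField_apply hφ hx]
    exact (hW _ (φ.map_target hx) _).1 (hU _)
  have hlie : coordField φ (lie X Y) e ∈ W := by
    rw [coordField_lie hφ hX hY he]
    exact lieBracket_mem W.closed_of_finiteDimensional (hcoord hXD) (hcoord hYD)
  rw [coordField_apply hφ he] at hlie
  exact (hW _ hz _).2 hlie

variable [T2Space M] {P : VOneForm E M} {φ : OpenPartialHomeomorph M E} {e : E}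

theorem exists_coordField_eq (hφ : φ ∈ IsManifold.maximalAtlas 𝓘(ℝ, E) ∞ M) (he : e ∈ φ.target)
    (v : E) : ∃ X : VField E M, SmoothField X ∧ coordField φ X e = v := by
  obtain ⟨X, hX, hXv⟩ := exists_smoothField_eq (φ.symm e) (mfderiv 𝓘(ℝ, E) 𝓘(ℝ, E) φ.symm e v)
  refine ⟨X, hX, ?_⟩
  rw [coordField_apply hφ he, hXv, mfderiv_mfderiv_symm hφ he]

theorem fderiv_coordForm_comm_of_involutive (hP : SmoothForm P)
    (hPP : ∀ z, IsIdempotentElem (P z)) (hinv : Involutive fun z ↦ (P z).range)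
    (hφ : φ ∈ IsManifold.maximalAtlas 𝓘(ℝ, E) ∞ M) (he : e ∈ φ.target) (x y : E) :
    fderiv ℝ (coordForm φ P) e (coordForm φ P e x) (coordForm φ P e y) =
      fderiv ℝ (coordForm φ P) e (coordForm φ P e y) (coordForm φ P e x) := by
  have : CompleteSpace E := FiniteDimensional.complete ℝ E
  have hnear := φ.open_target.mem_nhds he
  have hidem : ∀ᶠ x in 𝓝 e, IsIdempotentElem (coordForm φ P x) :=
    eventually_of_mem hnear fun _ ↦ isIdempotentElem_coordForm hφ hPP
  have hfix (v : E) : coordForm φ P e (coordForm φ P e v) = coordForm φ P e v :=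
    DFunLike.congr_fun hidem.self_of_nhds v
  have happ (X : VField E M) :
      coordField φ (app P X) =ᶠ[𝓝 e] fun x ↦ coordForm φ P x (coordField φ X x) :=
    eventually_of_mem hnear fun _ ↦ coordField_app hφ
  have hdiff {X : VField E M} (hX : SmoothField X) : DifferentiableAt ℝ (coordField φ X) e :=
    (contDiffAt_coordField hφ he (hX _)).differentiableAt (by simp)
  obtain ⟨X, hX, hXx⟩ := exists_coordField_eq hφ he (coordForm φ P e x)
  obtain ⟨Y, hY, hYy⟩ := exists_coordField_eq hφ he (coordForm φ P e y)
  have hPlie : app P (lie (app P X) (app P Y)) = lie (app P X) (app P Y) := by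
    funext z
    obtain ⟨η, hη⟩ := hinv _ _ (hP.smoothField_app hX) (hP.smoothField_app hY)
      (fun z ↦ ⟨X z, rfl⟩) (fun z ↦ ⟨Y z, rfl⟩) z
    rw [app, ← hη]
    exact DFunLike.congr_fun (hPP z) η
  have hlie := coordField_app (K := P) (X := lie (app P X) (app P Y)) hφ he
  rw [hPlie, coordField_lie hφ (hP.smoothField_app hX) (hP.smoothField_app hY) he,
    (happ X).lieBracket_vectorField_eq (happ Y)] at hlie
  rw [← hXx, ← hYy]
  exact fderiv_apply_comm_of_apply_lieBracket_eq
    (((contDiffOn_coordForm hφ hP).contDiffAt hnear).differentiableAt (by simp)) hidem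
    (hdiff hX) (hdiff hY) (by rw [hXx, hfix]) (by rw [hYy, hfix]) hlie.symm

theorem completelyIntegrable_range_of_involutive (hP : SmoothForm P)
    (hPP : ∀ z, IsIdempotentElem (P z)) (hinv : Involutive fun z ↦ (P z).range) :
    CompletelyIntegrable fun z ↦ (P z).range := by
  intro z
  have : CompleteSpace E := FiniteDimensional.complete ℝ E
  set φ := chartAt E z
  have hφ : φ ∈ IsManifold.maximalAtlas 𝓘(ℝ, E) ∞ M := IsManifold.chart_mem_maximalAtlas z
  have hnear := φ.open_target.mem_nhds (mem_chart_target E z)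
  obtain ⟨Ψ, hzΨ, hΨ, hΨsymm, W, hW⟩ := Frobenius.exists_flat_coordinates
    (eventually_of_mem hnear fun e he ↦
      (contDiffOn_coordForm hφ hP).contDiffAt (φ.open_target.mem_nhds he))
    (eventually_of_mem hnear fun e ↦ isIdempotentElem_coordForm hφ hPP)
    (eventually_of_mem hnear fun e ↦ fderiv_coordForm_comm_of_involutive hP hPP hinv hφ)
  refine ⟨φ.trans Ψ, trans_mem_maximalAtlas hφ hΨ hΨsymm, ⟨mem_chart_source E z, hzΨ⟩, W, ?_⟩
  rintro w ⟨hwφ, hwΨ⟩ ξ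
  obtain ⟨e, he, rfl⟩ : ∃ e ∈ φ.target, φ.symm e = w := ⟨φ w, φ.map_source hwφ, φ.left_inv hwφ⟩
  have heΨ : e ∈ Ψ.source := φ.right_inv he ▸ hwΨ
  have hΨe : MDifferentiableAt 𝓘(ℝ, E) 𝓘(ℝ, E) Ψ e :=
    ((hΨ.contDiffAt (Ψ.open_source.mem_nhds heΨ)).differentiableAt (by simp)).mdifferentiableAt
  have hcomp := mfderiv_comp_of_eq (x := φ.symm e) hΨe
    ((mdifferentiable_of_mem_maximalAtlas hφ).mdifferentiableAt hwφ) (φ.right_inv he)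
  rw [φ.right_inv he, mfderiv_eq_fderiv] at hcomp
  refine (mem_range_coordForm_iff hφ he ξ).symm.trans ((hW e heΨ _).trans ?_)
  exact iff_of_eq (congrArg (· ∈ W) (DFunLike.congr_fun hcomp ξ).symm)

end Integrability

section HorizontalProjector

variable {E : Type*} [NormedAddCommGroup E] [NormedSpace ℝ E]
  {M : Type*} [TopologicalSpace M] [ChartedSpace E M] {Γ : VOneForm E M}

theorem isIdempotentElem_hproj
    (hΓΓ : ∀ z, (Γ z).comp (Γ z) = ContinuousLinearMap.id ℝ (TangentSpace 𝓘(ℝ, E) z)) (z : M) :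
    IsIdempotentElem (hproj Γ z) := by
  ext ξ
  have hξ : Γ z (Γ z ξ) = ξ := DFunLike.congr_fun (hΓΓ z) ξ
  change (1 / 2 : ℝ) • ((1 / 2 : ℝ) • (ξ + Γ z ξ) + Γ z ((1 / 2 : ℝ) • (ξ + Γ z ξ))) =
    (1 / 2 : ℝ) • (ξ + Γ z ξ)
  rw [map_smul, map_add, hξ]
  module

theorem vanishes_curvature_iff [IsManifold 𝓘(ℝ, E) ∞ M] :
    Vanishes (curvature Γ) ↔ Vanishes (fnBracket (hproj Γ) (hproj Γ)) := by
  refine forall₄_congr fun X Y _ _ ↦ ?_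
  rw [curvature, neg_eq_zero, smul_eq_zero_iff_right (by norm_num)]

end HorizontalProjector

end LConn

end

theorem theorem7_general
    {E : Type*} [NormedAddCommGroup E] [NormedSpace ℝ E] [FiniteDimensional ℝ E]
    {M : Type*} [TopologicalSpace M] [ChartedSpace E M] [IsManifold 𝓘(ℝ, E) ∞ M] [T2Space M]
    {Γ : LConn.VOneForm E M} (hΓ : LConn.SmoothForm Γ)
    (hΓΓ : ∀ z, (Γ z).comp (Γ z) = ContinuousLinearMap.id ℝ (TangentSpace 𝓘(ℝ, E) z))
    (hker : LConn.Involutive fun z ↦ (LConn.hproj Γ z).ker) :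
    List.TFAE [
      LConn.CompletelyIntegrable (LConn.horizontal Γ),
      LConn.Vanishes (LConn.nijenhuis Γ),
      LConn.Vanishes (LConn.curvature Γ)] := by
  have : CompleteSpace E := FiniteDimensional.complete ℝ E
  have hidem := LConn.isIdempotentElem_hproj hΓΓ
  have hcurv : LConn.Vanishes (LConn.curvature Γ) ↔ LConn.Involutive (LConn.horizontal Γ) := by
    rw [LConn.vanishes_curvature_iff, LConn.vanishes_fnBracket_self_iff hΓ.hproj hidem]
    exact and_iff_left hker
  tfae_have 2 ↔ 3 := LConn.vanishes_nijenhuis_iff_vanishes_curvature hΓ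
  tfae_have 1 → 3 := fun h ↦ hcurv.2 h.involutive
  tfae_have 3 → 1 := fun h ↦
    LConn.completelyIntegrable_range_of_involutive hΓ.hproj hidem (hcurv.1 h)
  tfae_finish

/-- For an `L`-connection `Γ`: complete integrability of the horizontal distribution, vanishing of
the Nijenhuis tensor of `Γ` and vanishing of the curvature are equivalent. -/
theorem theorem7
    {E : Type*} [NormedAddCommGroup E] [NormedSpace ℝ E] [FiniteDimensional ℝ E]
    {M : Type*} [TopologicalSpace M] [ChartedSpace E M] [IsManifold 𝓘(ℝ, E) ∞ M]
    [T2Space M] [ParacompactSpace M]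
    (n : ℕ) (hn : 1 ≤ n)
    (L : LConn.VOneForm E M) (hL : LConn.IsTangentStructure n L)
    (Γ : LConn.VOneForm E M) (hΓ : LConn.IsLConnection L Γ) :
    List.TFAE [
      LConn.CompletelyIntegrable (LConn.horizontal Γ),
      LConn.Vanishes (LConn.nijenhuis Γ),
      LConn.Vanishes (LConn.curvature Γ)] :=
  have hker : LConn.Involutive fun z ↦ (LConn.hproj Γ z).ker := by
    simpa only [hΓ.ker_hproj hL] using hL.involutive_ker
  theorem7_general hΓ.smooth (hΓ.comp_self hL) hker
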